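/- Let $\mathbb{T}^n=\mathbb{R}^n/\mathbb{Z}^n$ with the flat distance induced by the Euclidean norm, and let $g:\mathbb{T}^n\to\mathbb{T}^n$ be a (bi-Lipschitz) homeomorphism homotopic to the identity such that the family $(g^k)_{k\in\mathbb{Z}}$ is $K$-equi-Lipschitz, i.e. $g^k$ is $K$-Lipschitz for every $k\in\mathbb{Z}$. Let $F:\mathbb{R}^n\to\mathbb{R}^n$ be a lift of $g$, i.e. a continuous map with $F(x)\equiv g(x \bmod \mathbb{Z}^n) \pmod{\mathbb{Z}^n}$ and $F(x+m)=F(x)+m$ for all $x\in\mathbb{R}^n$, $m\in\mathbb{Z}^n$. Then $\frac{F^k(x)-x}{k}$ converges as $k\to+\infty$, uniformly in $x\in\mathbb{R}^n$, to a (unique) constant $\alpha\in\mathbb{R}^n$, the rotation vector of $g$ (which depends on the choice of the lift only through its addition of an integer vector). Let $R_\alpha:\mathbb{T}^n\to\mathbb{T}^n$, $R_\alpha(x)=x+\alpha$. If $R_\alpha$ is ergodic with respect to the Lebesgue measure, then there is a bi-Lipschitz homeomorphism $h$ of $\mathbb{T}^n$ such that $h\circ g=R_\alpha\circ h$. Moreover,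 for every homeomorphism $h$ of $\mathbb{T}^n$ such that $h\circ g=R_\alpha\circ h$, the conjugation $h$ is $K$-Lipschitz and its inverse $h^{-1}$ is $K^n$-Lipschitz. -/

import Mathlib

/-- The flat torus `𝕋ⁿ = ℝⁿ/ℤⁿ`: the `ℓ²` product of `n` copies of `ℝ/ℤ`, whose distance
`(∑ i, dist (x i) (y i) ^ 2) ^ (1/2)` is the quotient of the Euclidean distance of `ℝⁿ`. -/
abbrev FlatTorus (n : ℕ) : Type := PiLp 2 (fun _ : Fin n => UnitAddCircle)

namespace FlatTorus

/-- The projection `ℝⁿ → 𝕋ⁿ`. -/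
def proj {n : ℕ} (x : EuclideanSpace ℝ (Fin n)) : FlatTorus n :=
  WithLp.toLp 2 (fun i => (x i : UnitAddCircle))

/-- An integer vector, seen in `ℝⁿ`. -/
def intVec {n : ℕ} (m : Fin n → ℤ) : EuclideanSpace ℝ (Fin n) :=
  WithLp.toLp 2 (fun i => (m i : ℝ))

/-- Lebesgue (Haar) probability measure of the torus. -/
noncomputable def leb (n : ℕ) : MeasureTheory.Measure (FlatTorus n) :=
  MeasureTheory.Measure.map (WithLp.toLp 2)
    (MeasureTheory.volume : MeasureTheory.Measure (Fin n → UnitAddCircle))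

/-- The rotation `R_α : 𝕋ⁿ → 𝕋ⁿ`, `x ↦ x + α`, of a vector `α` of `ℝⁿ`. -/
def rotation {n : ℕ} (α : EuclideanSpace ℝ (Fin n)) (x : FlatTorus n) : FlatTorus n :=
  x + proj α

/-- `F : ℝⁿ → ℝⁿ` is a continuous lift of `g : 𝕋ⁿ → 𝕋ⁿ` that commutes with the integer
translations, i.e. `F - id` is `ℤⁿ`-periodic. Such a lift exists exactly when `g` is (continuous and)
homotopic to the identity; it is unique up to adding an integer vector. -/
structure IsLift {n : ℕ} (F : EuclideanSpace ℝ (Fin n) → EuclideanSpace ℝ (Fin n))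
    (g : FlatTorus n → FlatTorus n) : Prop where
  continuous : Continuous F
  proj_apply : ∀ x, proj (F x) = g (proj x)
  add_intVec : ∀ x m, F (x + intVec m) = F x + intVec m

/-- `α` is the rotation vector of the lift `F`: `(F^k(x) - x)/k → α` as `k → +∞`, uniformly
in `x`. -/
def IsRotationVector {n : ℕ} (F : EuclideanSpace ℝ (Fin n) → EuclideanSpace ℝ (Fin n))
    (α : EuclideanSpace ℝ (Fin n)) : Prop :=
  TendstoUniformly (fun (k : ℕ) x => (k : ℝ)⁻¹ • (F^[k] x - x)) (fun _ => α) Filter.atTop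

end FlatTorus

/-!
Let `E = ℝⁿ`, `L = ℤⁿ`, and let `F` be the lift of `g`. The iterates of `F` are `K`-Lipschitz on `E`,
and so are those of the inverse at small scale (`FlatTorus.IsLift.isEquiLipschitzLift`).

*Rotation vector.* The displacements `F^[k] x - x` are periodic and equi-Lipschitz in `x`, so they
oscillate by a bounded amount. Hence `k ↦ F^[k] 0` is a quasimorphism, and `F^[k] x - x` stays at
bounded distance from `k • α` for one vector `α`
(`IsEquiLipschitzLift.exists_norm_iterate_sub_le`).

*Semiconjugacy.* A limit `H` of the averages of `F^[k] - k • α` is `K`-Lipschitz, commutes with `L`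
and satisfies `H ∘ F = H + α` (`IsEquiLipschitzLift.exists_semiconj`). An average of bi-Lipschitz
maps need not be bi-Lipschitz, so the injectivity of `H` requires an argument, as follows.

*Minimality of `g`.* By equicontinuity the orbit closures of `g` partition the torus. An ergodic
rotation is minimal, so each orbit closure is mapped onto the torus by the `K`-Lipschitz map `H`,
and therefore has volume at least `K⁻ⁿ`. So there are finitely many, they are open, and by
connectedness there is only one (`IsLiftedSemiconj.liftedOrbitClosure_eq_univ`).

*Expansion.* As `H` covers the torus, `|det DH| ≥ 1` at some point `y` of differentiability
(`IsLiftedSemiconj.exists_one_le_abs_det`). There `‖DH‖ ≤ K` and Hadamard's inequality give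
`K ‖v‖ ≤ Kⁿ ‖DH v‖` (`abs_det_mul_norm_le`). By minimality any two close points of `E` can be moved,
by an iterate of `F` and a lattice vector, to a pair near `y`. This costs one factor `K` and
preserves the difference of the values of `H` (`IsLiftedSemiconj.exists_transport`). Hence at small
scale `H` contracts distances by a factor at most arbitrarily close to `Kⁿ`.

*Conjugacy.* In particular `H` is locally injective. It is open by Baire's theorem and the same
transport argument, and proper since it is at bounded distance from the identity. So it is a
covering map of the simply connected space `E`, i.e. a homeomorphism, and its inverse is
`Kⁿ`-Lipschitz (`IsLiftedSemiconj.antilipschitz`); it descends to the torus. Finally, any two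
conjugacies differ by a homeomorphism commuting with a minimal rotation, which is a translation
(`FlatTorus.eq_add_of_commute_rotation`), so the Lipschitz bounds hold for all of them.
-/

open MeasureTheory Filter Topology Module

/-! ### Lipschitz maps, Hadamard's inequality and lattices -/

/-- A map that is `K`-Lipschitz around each point with respect to that point is `K`-Lipschitz: the
set of times at which the bound holds along a segment is closed and open to the right. -/
theorem lipschitzWith_of_eventually_dist_le {E M : Type*} [NormedAddCommGroup E] [NormedSpace ℝ E]
    [PseudoMetricSpace M] {f : E → M} {K : NNReal}
    (hf : ∀ x, ∀ᶠ y in 𝓝 x, dist (f y) (f x) ≤ K * dist y x) : LipschitzWith K f := by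
  have hcont : Continuous f := by
    rw [continuous_iff_continuousAt]
    intro x
    rw [ContinuousAt, tendsto_iff_dist_tendsto_zero]
    refine squeeze_zero' (Eventually.of_forall fun _ => dist_nonneg) (hf x) ?_
    have : Continuous fun y => K * dist y x := by fun_prop
    simpa using this.tendsto x
  refine LipschitzWith.of_dist_le_mul fun a b => ?_
  let p : ℝ → E := fun t => a + t • (b - a)
  have hp : Continuous p := by fun_prop
  have hdist : ∀ s t, dist (p s) (p t) = |s - t| * dist a b := fun s t => by
    simp only [p, dist_eq_norm, add_sub_add_left_eq_sub, ← sub_smul, norm_smul, Real.norm_eq_abs]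
    rw [norm_sub_rev b a]
  let s : Set ℝ := {t | dist (f (p t)) (f a) ≤ K * (t * dist a b)}
  have hs : IsClosed s := isClosed_le (by fun_prop) (by fun_prop)
  have key : Set.Icc (0 : ℝ) 1 ⊆ s := by
    refine IsClosed.Icc_subset_of_forall_mem_nhdsWithin (hs.inter isClosed_Icc) (by simp [s, p]) ?_
    rintro t ⟨ht, -⟩
    have h1 : ∀ᶠ r in 𝓝[>] t, dist (f (p r)) (f (p t)) ≤ K * dist (p r) (p t) :=
      ((hp.tendsto t).eventually (hf (p t))).filter_mono nhdsWithin_le_nhds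
    filter_upwards [h1, self_mem_nhdsWithin] with r hr htr
    have htr' : t < r := htr
    rw [hdist, abs_of_pos (sub_pos.2 htr')] at hr
    have ht' : dist (f (p t)) (f a) ≤ K * (t * dist a b) := ht
    calc dist (f (p r)) (f a) ≤ _ := dist_triangle _ (f (p t)) _
      _ ≤ K * ((r - t) * dist a b) + K * (t * dist a b) := add_le_add hr ht'
      _ = K * (r * dist a b) := by ring
  have h1 := key (Set.right_mem_Icc.2 zero_le_one)
  simp only [s, p, Set.mem_ofPred_eq, one_smul, one_mul, add_sub_cancel] at h1
  rwa [dist_comm]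

/-- Hadamard's inequality, in the form: a linear map that expands no vector by more than `K`
contracts no vector `v` by more than `K ^ (n - 1) / |det A|`. -/
theorem abs_det_mul_norm_le {E : Type*} [NormedAddCommGroup E] [InnerProductSpace ℝ E]
    [FiniteDimensional ℝ E] (A : E →L[ℝ] E) {K : ℝ} (hA : ‖A‖ ≤ K) (v : E) :
    |A.det| * ‖v‖ ≤ K ^ (finrank ℝ E - 1) * ‖A v‖ := by
  have hK : 0 ≤ K := (norm_nonneg _).trans hA
  rcases eq_or_ne v 0 with rfl | hv
  · simp
  obtain ⟨d, hd⟩ : ∃ d, finrank ℝ E = d + 1 := by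
    have : Nontrivial E := ⟨v, 0, hv⟩
    exact ⟨_, (Nat.succ_pred_eq_of_pos finrank_pos).symm⟩
  have hcard : finrank ℝ E = Fintype.card (Fin (d + 1)) := by simpa using hd
  have hw : ‖(‖v‖⁻¹ • v : E)‖ = 1 := by
    rw [norm_smul, norm_inv, norm_norm, inv_mul_cancel₀ (norm_ne_zero_iff.2 hv)]
  obtain ⟨e, he⟩ := Orthonormal.exists_orthonormalBasis_extension_of_card_eq hcard
    (v := fun _ : Fin (d + 1) => (‖v‖⁻¹ • v : E)) (s := {0})
    ⟨fun _ => hw, fun i j hij => absurd (Subsingleton.elim i j) hij⟩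
  have he0 : e 0 = ‖v‖⁻¹ • v := he 0 rfl
  have hdet : |A.det| ≤ ∏ i, ‖A (e i)‖ := by
    have : Fact (finrank ℝ E = d + 1) := ⟨hd⟩
    have h1 := (e.toBasis.orientation).abs_volumeForm_apply_le (fun i => A (e i))
    rw [(e.toBasis.orientation).volumeForm_robust' e] at h1
    have h2 : e.toBasis.det (fun i => A (e i)) = A.det := by
      have := e.toBasis.det_comp (A : E →ₗ[ℝ] E) e
      rw [← e.coe_toBasis, e.toBasis.det_self, mul_one] at this
      rw [← e.coe_toBasis]; exact this
    rwa [h2] at h1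
  have h3 : ∏ i, ‖A (e i)‖ ≤ ‖A (e 0)‖ * K ^ d := by
    rw [Fin.prod_univ_succ]
    refine mul_le_mul_of_nonneg_left ?_ (norm_nonneg _)
    refine (Finset.prod_le_prod (fun i _ => norm_nonneg _) fun i _ =>
      (?_ : ‖A (e i.succ)‖ ≤ K)).trans (by simp)
    refine (A.le_opNorm _).trans ?_
    simpa using hA
  rw [he0, map_smul, norm_smul, norm_inv, norm_norm] at h3
  rw [hd, Nat.add_sub_cancel]
  have hv' : 0 < ‖v‖ := norm_pos_iff.2 hv
  calc |A.det| * ‖v‖ ≤ (‖v‖⁻¹ * ‖A v‖ * K ^ d) * ‖v‖ := by gcongr; exact hdet.trans h3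
    _ = K ^ d * ‖A v‖ := by field_simp

/-- Nonzero vectors of a lattice are bounded below. -/
theorem exists_pos_forall_mem_lattice_norm_lt {E : Type*} [NormedAddCommGroup E]
    (L : Submodule ℤ E) [DiscreteTopology L] : ∃ r > 0, ∀ m ∈ L, ‖m‖ < r → m = 0 := by
  have h : ({0} : Set L) ∈ 𝓝 (0 : L) := (isOpen_discrete _).mem_nhds rfl
  obtain ⟨r, hr, h⟩ := Metric.mem_nhds_iff.1 h
  refine ⟨r, hr, fun m hm hmr => ?_⟩
  have : (⟨m, hm⟩ : L) ∈ Metric.ball (0 : L) r := by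
    rw [mem_ball_zero_iff]; exact hmr
  exact congrArg Subtype.val (h this)

section Lattice

variable {E : Type*} [NormedAddCommGroup E] [NormedSpace ℝ E] [FiniteDimensional ℝ E]
  [MeasurableSpace E] [BorelSpace E] (L : Submodule ℤ E) [DiscreteTopology L] [IsZLattice ℝ L]

/-- A bounded fundamental domain of a lattice has the least measure among all sets whose translates
by the lattice cover the space. -/
theorem exists_bounded_fundamentalDomain (μ : Measure E) [μ.IsAddHaarMeasure] :
    ∃ Q : Set E, Bornology.IsBounded Q ∧ MeasurableSet Q ∧ (∀ x, ∃ m ∈ L, x + m ∈ Q) ∧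
      μ Q ≠ 0 ∧ μ Q ≠ ⊤ ∧ ∀ T : Set E, (∀ x, ∃ m ∈ L, x + m ∈ T) → μ Q ≤ μ T := by
  let b := (Free.chooseBasis ℤ L).ofZLatticeBasis ℝ
  have hQ : IsAddFundamentalDomain L (ZSpan.fundamentalDomain b) μ :=
    ZLattice.isAddFundamentalDomain (Free.chooseBasis ℤ L) μ
  have hspan : Submodule.span ℤ (Set.range b) = L :=
    (Free.chooseBasis ℤ L).ofZLatticeBasis_span ℝ
  refine ⟨ZSpan.fundamentalDomain b, ZSpan.fundamentalDomain_isBounded b,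
    ZSpan.fundamentalDomain_measurableSet b, fun x => ?_, ZSpan.measure_fundamentalDomain_ne_zero b,
    (ZSpan.fundamentalDomain_isBounded b).measure_lt_top.ne, fun T hT => ?_⟩
  · obtain ⟨v, hv, -⟩ := ZSpan.exist_unique_vadd_mem_fundamentalDomain b x
    refine ⟨v, hspan.le v.2, ?_⟩
    rwa [add_comm]
  · have : VAddInvariantMeasure L E μ :=
      inferInstanceAs (VAddInvariantMeasure L.toAddSubgroup E μ)
    have : MeasurableConstVAdd L E := inferInstanceAs (MeasurableConstVAdd L.toAddSubgroup E)
    rw [hQ.measure_eq_tsum T]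
    refine (measure_mono fun x hx => ?_).trans (measure_iUnion_le _)
    obtain ⟨m, hm, hmT⟩ := hT x
    refine Set.mem_iUnion.2 ⟨-⟨m, hm⟩, ⟨x + m, hmT, ?_⟩, hx⟩
    change -m + (x + m) = x
    abel

end Lattice

/-! ### Rotation vector and semiconjugacy of an equi-Lipschitz lift -/

/-- The properties of the lift `F` of an equi-Lipschitz homeomorphism of the torus `E / L` on which
the dynamical argument rests. The last one says that the inverse of `F^[k]` is `K`-Lipschitz as a
map of the torus; it is stated without the lift of this inverse. -/
structure IsEquiLipschitzLift {E : Type*} [NormedAddCommGroup E] (L : Submodule ℤ E) (K : NNReal)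
    (F : E → E) : Prop where
  map_add : ∀ x, ∀ m ∈ L, F (x + m) = F x + m
  lipschitz : ∀ k : ℕ, LipschitzWith K F^[k]
  exists_norm_sub_le : ∀ (k : ℕ) (a b : E), ∃ m ∈ L, ‖a - b - m‖ ≤ K * ‖F^[k] a - F^[k] b‖

namespace IsEquiLipschitzLift

variable {E : Type*} [NormedAddCommGroup E] {L : Submodule ℤ E} {K : NNReal} {F : E → E}

theorem iterate_add (hF : IsEquiLipschitzLift L K F) (k : ℕ) (x : E) {m : E} (hm : m ∈ L) :
    F^[k] (x + m) = F^[k] x + m := by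
  induction k generalizing x with
  | zero => rfl
  | succ k ih => rw [Function.iterate_succ_apply, hF.map_add x m hm, ih,
      Function.iterate_succ_apply]

theorem norm_iterate_sub_le (hF : IsEquiLipschitzLift L K F) (k : ℕ) (x y : E) :
    ‖F^[k] x - F^[k] y‖ ≤ K * ‖x - y‖ := by
  simpa [dist_eq_norm] using (hF.lipschitz k).dist_le_mul x y

/-- Below half the length of the shortest lattice vector, the inverses of the iterates are
`K`-Lipschitz. -/
theorem norm_sub_le_of_lt (hF : IsEquiLipschitzLift L K F) {r : ℝ} (hr : ∀ m ∈ L, ‖m‖ < r → m = 0)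
    (k : ℕ) {a b : E} (hab : ‖a - b‖ < r / 2) : ‖a - b‖ ≤ K * ‖F^[k] a - F^[k] b‖ := by
  obtain ⟨m, hm, h⟩ := hF.exists_norm_sub_le k a b
  rcases eq_or_ne m 0 with rfl | hm0
  · simpa using h
  have h1 : r ≤ ‖m‖ := not_lt.1 fun hlt => hm0 (hr m hm hlt)
  have h2 : ‖m‖ ≤ ‖a - b‖ + ‖a - b - m‖ := by
    have := norm_sub_le (a - b) (a - b - m)
    rwa [sub_sub_cancel] at this
  linarith

variable [NormedSpace ℝ E] [FiniteDimensional ℝ E]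

section Displacement

variable [DiscreteTopology L] [IsZLattice ℝ L]

/-- The displacements of all the iterates have uniformly bounded oscillation, because they are
`L`-periodic and equi-Lipschitz. -/
theorem exists_displacement_sub_le (hF : IsEquiLipschitzLift L K F) :
    ∃ C, ∀ (k : ℕ) (x y : E), ‖(F^[k] x - x) - (F^[k] y - y)‖ ≤ C := by
  borelize E
  obtain ⟨Q, hQ, -, hcov, -⟩ := exists_bounded_fundamentalDomain L (Measure.addHaar : Measure E)
  obtain ⟨R, hR⟩ := hQ.exists_norm_le
  refine ⟨K * (R + R) + (R + R), fun k x y => ?_⟩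
  obtain ⟨m, hm, hx⟩ := hcov x
  obtain ⟨m', hm', hy⟩ := hcov y
  have hxy : ‖(x + m) - (y + m')‖ ≤ R + R :=
    (norm_sub_le _ _).trans (add_le_add (hR _ hx) (hR _ hy))
  have e : (F^[k] x - x) - (F^[k] y - y)
      = (F^[k] (x + m) - F^[k] (y + m')) - ((x + m) - (y + m')) := by
    rw [hF.iterate_add k x hm, hF.iterate_add k y hm']
    abel
  rw [e]
  refine (norm_sub_le _ _).trans (add_le_add ((hF.norm_iterate_sub_le k _ _).trans ?_) hxy)
  gcongr

/-- The orbits of the lift stay at bounded distance from those of a translation: `k ↦ F^[k] 0` is a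
quasimorphism up to a bounded error, and the translation vector is its homogenization. -/
theorem exists_norm_iterate_sub_le (hF : IsEquiLipschitzLift L K F) :
    ∃ (α : E) (C : ℝ), ∀ (k : ℕ) (x : E), ‖F^[k] x - x - (k : ℝ) • α‖ ≤ C := by
  obtain ⟨C, hC⟩ := hF.exists_displacement_sub_le
  have hC0 : 0 ≤ C := (norm_nonneg _).trans (hC 0 0 0)
  let a : ℕ → E := fun k => F^[k] 0
  have hadd : ∀ k l, ‖a (k + l) - a k - a l‖ ≤ C := fun k l => by
    have := hC k (F^[l] 0) 0
    rw [← Function.iterate_add_apply, sub_zero] at this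
    convert this using 2
    simp only [a]; abel
  have hmul : ∀ k j : ℕ, ‖a (j * k) - (j : ℝ) • a k‖ ≤ j * C := fun k j => by
    induction j with
    | zero => simp [a]
    | succ j ih =>
      have e : a ((j + 1) * k) - ((j + 1 : ℕ) : ℝ) • a k
          = (a (j * k) - (j : ℝ) • a k) + (a (j * k + k) - a (j * k) - a k) := by
        rw [Nat.succ_mul]; push_cast; rw [add_smul, one_smul]; abel
      rw [e]
      refine (norm_add_le _ _).trans ((add_le_add ih (hadd _ _)).trans ?_)
      push_cast; linarith
  have hbdd : ∀ j : ℕ, (j : ℝ)⁻¹ • a j ∈ Metric.closedBall (0 : E) (‖a 1‖ + C) := fun j => by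
    rw [mem_closedBall_zero_iff, norm_smul, norm_inv, RCLike.norm_natCast]
    rcases Nat.eq_zero_or_pos j with rfl | hj
    · simp; positivity
    have hj' : (0 : ℝ) < j := by exact_mod_cast hj
    rw [inv_mul_le_iff₀ hj']
    have h1 := hmul 1 j
    rw [mul_one] at h1
    have h2 := norm_add_le (a j - (j : ℝ) • a 1) ((j : ℝ) • a 1)
    rw [sub_add_cancel, norm_smul, RCLike.norm_natCast] at h2
    linarith
  obtain ⟨α, -, hα⟩ := (isCompact_closedBall (0 : E) (‖a 1‖ + C)).ultrafilter_le_nhds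
    ((hyperfilter ℕ).map fun j : ℕ => (j : ℝ)⁻¹ • a j)
    (le_principal_iff.2 (Eventually.of_forall (f := (hyperfilter ℕ : Filter ℕ)) hbdd))
  have hα' : Tendsto (fun j : ℕ => (j : ℝ)⁻¹ • a j) (hyperfilter ℕ) (𝓝 α) := hα
  have hle : (hyperfilter ℕ : Filter ℕ) ≤ atTop := Nat.hyperfilter_le_atTop
  refine ⟨α, C + C, fun k x => ?_⟩
  have hk : ‖a k - (k : ℝ) • α‖ ≤ C := by
    have h1 : Tendsto (fun j : ℕ => ‖a k - (k : ℝ) • ((j : ℝ)⁻¹ • a j)‖) (hyperfilter ℕ)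
        (𝓝 ‖a k - (k : ℝ) • α‖) := ((hα'.const_smul (k : ℝ)).const_sub (a k)).norm
    have h2 : Tendsto (fun j : ℕ => C + k * C * (j : ℝ)⁻¹) (hyperfilter ℕ) (𝓝 (C + k * C * 0)) :=
      ((tendsto_inv_atTop_nhds_zero_nat.mono_left hle).const_mul (k * C)).const_add C
    rw [mul_zero, add_zero] at h2
    refine le_of_tendsto_of_tendsto h1 h2 (hle ?_)
    filter_upwards [eventually_gt_atTop 0] with j hj
    have hj' : (0 : ℝ) < j := by exact_mod_cast hj
    -- `a (j k)` is within `j C` of `j a k` and within `k C` of `k a j`; divide by `j`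
    have e : a k - (k : ℝ) • ((j : ℝ)⁻¹ • a j)
        = (j : ℝ)⁻¹ • ((a (k * j) - (k : ℝ) • a j) - (a (j * k) - (j : ℝ) • a k)) := by
      rw [mul_comm k j, sub_sub_sub_cancel_left, smul_sub, inv_smul_smul₀ hj'.ne', smul_comm]
    rw [e, norm_smul, norm_inv, RCLike.norm_natCast, inv_mul_le_iff₀ hj']
    refine (norm_sub_le _ _).trans ((add_le_add (hmul j k) (hmul k j)).trans (le_of_eq ?_))
    field_simp
    ring
  have e : F^[k] x - x - (k : ℝ) • α
      = ((F^[k] x - x) - (F^[k] 0 - 0)) + (a k - (k : ℝ) • α) := by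
    simp only [a]; abel
  rw [e]
  exact (norm_add_le _ _).trans (add_le_add (hC k x 0) hk)

end Displacement

/-- The averages of `F^[k] - k • α` have limits along an ultrafilter, which semiconjugate `F` to the
translation by `α`. -/
theorem exists_semiconj (hF : IsEquiLipschitzLift L K F) {α : E} {C : ℝ}
    (hα : ∀ (k : ℕ) (x : E), ‖F^[k] x - x - (k : ℝ) • α‖ ≤ C) :
    ∃ H : E → E, LipschitzWith K H ∧ (∀ x, ∀ m ∈ L, H (x + m) = H x + m) ∧
      (∀ x, H (F x) = H x + α) ∧ ∀ x, ‖H x - x‖ ≤ C := by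
  let A : ℕ → E → E := fun N x => (N : ℝ)⁻¹ • ∑ k ∈ Finset.range N, (F^[k] x - (k : ℝ) • α)
  have hle : (hyperfilter ℕ : Filter ℕ) ≤ atTop := Nat.hyperfilter_le_atTop
  have hpos : ∀ᶠ N : ℕ in (hyperfilter ℕ : Filter ℕ), 0 < N := hle (eventually_gt_atTop 0)
  have havg : ∀ {u : ℕ → E} {D : ℝ} {N : ℕ}, 0 < N → (∀ k, ‖u k‖ ≤ D) →
      ‖(N : ℝ)⁻¹ • ∑ k ∈ Finset.range N, u k‖ ≤ D := fun {u D N} hN hu => by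
    have hN' : (0 : ℝ) < N := by exact_mod_cast hN
    rw [norm_smul, norm_inv, RCLike.norm_natCast, inv_mul_le_iff₀ hN']
    refine (norm_sum_le_of_le _ fun k _ => hu k).trans ?_
    simp
  have hsub : ∀ {N : ℕ} (_ : 0 < N) (x z : E),
      A N x - z = (N : ℝ)⁻¹ • ∑ k ∈ Finset.range N, (F^[k] x - (k : ℝ) • α - z) :=
    fun {N} hN x z => by
    have hN' : (N : ℝ) ≠ 0 := by exact_mod_cast hN.ne'
    rw [Finset.sum_sub_distrib, smul_sub]
    simp [A, ← Nat.cast_smul_eq_nsmul ℝ, inv_smul_smul₀ hN']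
  have hAb : ∀ {N : ℕ} (_ : 0 < N) (x : E), ‖A N x - x‖ ≤ C := fun {N} hN x => by
    rw [hsub hN]
    refine havg hN fun k => ?_
    rw [sub_right_comm]
    exact hα k x
  have hlim : ∀ x, ∃ y, Tendsto (fun N => A N x) (hyperfilter ℕ) (𝓝 y) := fun x => by
    obtain ⟨y, -, hy⟩ := (isCompact_closedBall x C).ultrafilter_le_nhds
      ((hyperfilter ℕ).map fun N => A N x) (le_principal_iff.2 (hpos.mono fun N hN => by
        refine mem_closedBall_iff_norm.2 ?_
        exact hAb hN x))
    exact ⟨y, hy⟩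
  choose H hH using hlim
  refine ⟨H, LipschitzWith.of_dist_le_mul fun x y => ?_, fun x m hm => ?_, fun x => ?_, fun x => ?_⟩
  · refine le_of_tendsto ((hH x).dist (hH y)) ?_
    filter_upwards [hpos] with N hN
    rw [dist_eq_norm, dist_eq_norm]
    simp only [A]
    rw [← smul_sub, ← Finset.sum_sub_distrib]
    refine havg hN fun k => ?_
    rw [sub_sub_sub_cancel_right]
    exact hF.norm_iterate_sub_le k x y
  · refine tendsto_nhds_unique (hH (x + m)) (((hH x).add_const m).congr' ?_)
    filter_upwards [hpos] with N hN
    rw [eq_comm, ← sub_eq_iff_eq_add, hsub hN]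
    simp only [A, hF.iterate_add _ x hm]
    congr 1
    exact Finset.sum_congr rfl fun k _ => by abel
  · have h0 : Tendsto (fun N => A N (F x) - A N x - α) (hyperfilter ℕ) (𝓝 (H (F x) - H x - α)) :=
      ((hH (F x)).sub (hH x)).sub_const α
    have h1 : Tendsto (fun N : ℕ => (N : ℝ)⁻¹ * C) (hyperfilter ℕ) (𝓝 (0 * C)) :=
      (tendsto_inv_atTop_nhds_zero_nat.mono_left hle).mul_const C
    rw [zero_mul] at h1
    have h2 := tendsto_nhds_unique h0 (squeeze_zero_norm' (hpos.mono fun N hN => ?_) h1)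
    · rw [sub_sub, sub_eq_zero] at h2; exact h2
    -- the difference of the two averages telescopes
    have hN' : (N : ℝ) ≠ 0 := by exact_mod_cast hN.ne'
    have e : A N (F x) - A N x - α = (N : ℝ)⁻¹ • (F^[N] x - x - (N : ℝ) • α) := by
      rw [sub_sub, hsub hN]
      simp only [A]
      have : ∑ k ∈ Finset.range N, (F^[k] (F x) - (k : ℝ) • α - (A N x + α))
          = ∑ k ∈ Finset.range N, ((F^[k + 1] x - ((k + 1 : ℕ) : ℝ) • α) - (F^[k] x - (k : ℝ) • α))
            + (∑ k ∈ Finset.range N, (F^[k] x - (k : ℝ) • α) - (N : ℝ) • A N x) := by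
        rw [add_sub, ← Finset.sum_add_distrib, eq_sub_iff_add_eq]
        have : (N : ℝ) • A N x = ∑ k ∈ Finset.range N, A N x := by
          simp [← Nat.cast_smul_eq_nsmul ℝ]
        rw [this, ← Finset.sum_add_distrib]
        refine Finset.sum_congr rfl fun k _ => ?_
        rw [Function.iterate_succ_apply]; push_cast; rw [add_smul, one_smul]; abel
      rw [this, Finset.sum_range_sub (fun k => F^[k] x - (k : ℝ) • α)]
      simp only [A, smul_inv_smul₀ hN', sub_self, add_zero]
      simp [sub_right_comm]
    rw [e, norm_smul, norm_inv, RCLike.norm_natCast]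
    gcongr
    exact hα N x
  · refine le_of_tendsto ((hH x).sub_const x).norm ?_
    filter_upwards [hpos] with N hN using hAb hN x

end IsEquiLipschitzLift

/-! ### Orbit closures and volume: minimality -/

/-- `H` is the lift of a `K`-Lipschitz map of the torus `E / L`, homotopic to the identity, that
semiconjugates the map with lift `F` to the rotation by `α`. -/
structure IsLiftedSemiconj {E : Type*} [NormedAddCommGroup E] (L : Submodule ℤ E) (K : NNReal)
    (F : E → E) (α : E) (H : E → E) : Prop where
  lipschitz : LipschitzWith K H
  map_add : ∀ x, ∀ m ∈ L, H (x + m) = H x + m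
  map_apply : ∀ x, H (F x) = H x + α
  exists_norm_sub_le : ∃ C, ∀ x, ‖H x - x‖ ≤ C

/-- The full preimage in `E` of the closure of the forward orbit of a point of `E / L`. -/
def liftedOrbitClosure {E : Type*} [NormedAddCommGroup E] (L : Submodule ℤ E) (F : E → E) (x : E) :
    Set E :=
  closure {y | ∃ k : ℕ, ∃ m ∈ L, F^[k] x + m = y}

section OrbitClosure

variable {E : Type*} [NormedAddCommGroup E] {L : Submodule ℤ E} {K : NNReal} {F H : E → E} {α : E}

theorem mem_liftedOrbitClosure_iff {x y : E} :
    y ∈ liftedOrbitClosure L F x ↔ ∀ ε > 0, ∃ k : ℕ, ∃ m ∈ L, ‖F^[k] x + m - y‖ < ε := by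
  rw [liftedOrbitClosure, Metric.mem_closure_iff]
  refine forall₂_congr fun ε _ => ⟨?_, ?_⟩
  · rintro ⟨_, ⟨k, m, hm, rfl⟩, h⟩
    exact ⟨k, m, hm, by rwa [dist_comm, dist_eq_norm] at h⟩
  · rintro ⟨k, m, hm, h⟩
    exact ⟨_, ⟨k, m, hm, rfl⟩, by rwa [dist_comm, dist_eq_norm]⟩

theorem self_mem_liftedOrbitClosure (x : E) : x ∈ liftedOrbitClosure L F x :=
  subset_closure ⟨0, 0, L.zero_mem, by simp⟩

theorem isClosed_liftedOrbitClosure (x : E) : IsClosed (liftedOrbitClosure L F x) :=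
  isClosed_closure

theorem IsEquiLipschitzLift.liftedOrbitClosure_subset (hF : IsEquiLipschitzLift L K F) {x y : E}
    (hy : y ∈ liftedOrbitClosure L F x) : liftedOrbitClosure L F y ⊆ liftedOrbitClosure L F x := by
  intro z hz
  rw [mem_liftedOrbitClosure_iff] at *
  intro ε hε
  obtain ⟨k, m, hm, h1⟩ := hz (ε / 2) (by positivity)
  obtain ⟨l, p, hp, h2⟩ := hy (ε / 2 / (K + 1)) (by positivity)
  refine ⟨k + l, p + m, L.add_mem hp hm, ?_⟩
  have h3 := hF.norm_iterate_sub_le k (F^[l] x + p) y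
  rw [hF.iterate_add k _ hp, ← Function.iterate_add_apply] at h3
  have h4 : K * ‖F^[l] x + p - y‖ ≤ ε / 2 := by
    rw [lt_div_iff₀ (by positivity)] at h2
    nlinarith [norm_nonneg (F^[l] x + p - y)]
  have e : F^[k + l] x + (p + m) - z = (F^[k + l] x + p - F^[k] y) + (F^[k] y + m - z) := by abel
  rw [e]
  exact (norm_add_le _ _).trans_lt (by linarith)

theorem IsEquiLipschitzLift.add_mem_liftedOrbitClosure (hF : IsEquiLipschitzLift L K F) {x y m : E}
    (hm : m ∈ L) (hy : y ∈ liftedOrbitClosure L F x) : y + m ∈ liftedOrbitClosure L F x :=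
  hF.liftedOrbitClosure_subset hy (subset_closure ⟨0, m, hm, rfl⟩)

section Recurrence

variable [NormedSpace ℝ E] [FiniteDimensional ℝ E] [DiscreteTopology L] [IsZLattice ℝ L]

/-- Every point of the torus is recurrent, at arbitrarily late times. -/
theorem IsEquiLipschitzLift.exists_iterate_add_near (hF : IsEquiLipschitzLift L K F) (x : E)
    {ε : ℝ} (hε : 0 < ε) (N : ℕ) : ∃ l ≥ N, ∃ m ∈ L, ‖F^[l] x + m - x‖ < ε := by
  borelize E
  obtain ⟨Q, hQ, -, hcov, -⟩ := exists_bounded_fundamentalDomain L (Measure.addHaar : Measure E)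
  choose p hpL hpQ using fun j : ℕ => hcov (F^[N * j] x)
  obtain ⟨z, -, φ, hφ, hz⟩ := tendsto_subseq_of_bounded hQ hpQ
  obtain ⟨i₀, hi₀⟩ := Metric.cauchySeq_iff.1 hz.cauchySeq (ε / (K + 1)) (by positivity)
  have hlt := hφ (Nat.lt_succ_self i₀)
  obtain ⟨d, hd⟩ := Nat.exists_eq_add_of_lt hlt
  -- two visits close to each other, at times `N * φ i₀` and `N * φ (i₀ + 1)`; cancel the first one
  have hclose := hi₀ (i₀ + 1) (Nat.le_succ _) i₀ le_rfl
  simp only [Function.comp_apply, dist_eq_norm, hd] at hclose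
  have e : N * (φ i₀ + d + 1) = N * φ i₀ + N * (d + 1) := by ring
  set q := p (φ i₀ + d + 1)
  have hq : q - p (φ i₀) ∈ L := L.sub_mem (hpL _) (hpL _)
  obtain ⟨m, hm, h⟩ := hF.exists_norm_sub_le (N * φ i₀) (F^[N * (d + 1)] x + (q - p (φ i₀))) x
  refine ⟨N * (d + 1), Nat.le_mul_of_pos_right _ (Nat.succ_pos _), q - p (φ i₀) - m,
    L.sub_mem hq hm, ?_⟩
  rw [hF.iterate_add _ _ hq, ← Function.iterate_add_apply, ← e] at h
  have e2 : F^[N * (φ i₀ + d + 1)] x + (q - p (φ i₀)) - F^[N * φ i₀] x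
      = F^[N * (φ i₀ + d + 1)] x + q - (F^[N * φ i₀] x + p (φ i₀)) := by abel
  rw [e2] at h
  have e3 : F^[N * (d + 1)] x + (q - p (φ i₀)) - x - m
      = F^[N * (d + 1)] x + (q - p (φ i₀) - m) - x := by abel
  rw [e3] at h
  refine h.trans_lt ?_
  rw [lt_div_iff₀ (by positivity)] at hclose
  have := norm_nonneg (F^[N * (φ i₀ + d + 1)] x + q - (F^[N * φ i₀] x + p (φ i₀)))
  linarith

/-- The orbit closures form a partition. -/
theorem IsEquiLipschitzLift.mem_liftedOrbitClosure_symm (hF : IsEquiLipschitzLift L K F) {x y : E}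
    (hy : y ∈ liftedOrbitClosure L F x) : x ∈ liftedOrbitClosure L F y := by
  rw [mem_liftedOrbitClosure_iff] at *
  intro ε hε
  obtain ⟨k, m, hm, h1⟩ := hy (ε / 2 / (K + 1)) (by positivity)
  obtain ⟨l, hl, p, hp, h2⟩ := hF.exists_iterate_add_near x (half_pos hε) k
  refine ⟨l - k, p - m, L.sub_mem hp hm, ?_⟩
  have h3 := hF.norm_iterate_sub_le (l - k) y (F^[k] x + m)
  rw [hF.iterate_add _ _ hm, ← Function.iterate_add_apply, Nat.sub_add_cancel hl,
    norm_sub_rev y] at h3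
  have h4 : K * ‖F^[k] x + m - y‖ ≤ ε / 2 := by
    rw [lt_div_iff₀ (by positivity)] at h1
    nlinarith [norm_nonneg (F^[k] x + m - y)]
  have e : F^[l - k] y + (p - m) - x = (F^[l - k] y - (F^[l] x + m)) + (F^[l] x + p - x) := by abel
  rw [e]
  exact (norm_add_le _ _).trans_lt (by linarith)

end Recurrence

end OrbitClosure

namespace IsLiftedSemiconj

variable {E : Type*} [NormedAddCommGroup E] [NormedSpace ℝ E] {L : Submodule ℤ E} {K : NNReal}
  {F H : E → E} {α : E}

theorem map_iterate (hH : IsLiftedSemiconj L K F α H) (k : ℕ) (x : E) :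
    H (F^[k] x) = H x + (k : ℝ) • α := by
  induction k with
  | zero => simp
  | succ k ih =>
    rw [Function.iterate_succ_apply', hH.map_apply, ih]
    push_cast
    rw [add_smul, one_smul, add_assoc]

/-- The image of the part in `Q` of an `L`-invariant set that is mapped onto the whole space is at
least as large as `Q`, because its translates cover the space. -/
theorem measure_le_of_image_eq_univ [MeasurableSpace E] [BorelSpace E]
    (hH : IsLiftedSemiconj L K F α H) {Q A : Set E}
    (hcov : ∀ x, ∃ m ∈ L, x + m ∈ Q)
    (hmin : ∀ T : Set E, (∀ x, ∃ m ∈ L, x + m ∈ T) → μH[finrank ℝ E] Q ≤ μH[finrank ℝ E] T)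
    (hA : ∀ x ∈ A, ∀ m ∈ L, x + m ∈ A) (hHA : H '' A = Set.univ) :
    μH[finrank ℝ E] Q ≤ μH[finrank ℝ E] (H '' (A ∩ Q)) := by
  refine hmin _ fun x => ?_
  obtain ⟨y, hy, rfl⟩ : x ∈ H '' A := hHA ▸ Set.mem_univ x
  obtain ⟨m, hm, hym⟩ := hcov y
  exact ⟨m, hm, y + m, ⟨hA y hy m hm, hym⟩, hH.map_add y m hm⟩

variable [FiniteDimensional ℝ E]

theorem isProperMap (hH : IsLiftedSemiconj L K F α H) : IsProperMap H := by
  have := FiniteDimensional.proper_real E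
  rw [isProperMap_iff_tendsto_cocompact]
  refine ⟨hH.lipschitz.continuous, ?_⟩
  obtain ⟨C, hC⟩ := hH.exists_norm_sub_le
  rw [← Metric.cobounded_eq_cocompact, ← tendsto_norm_atTop_iff_cobounded]
  have h := tendsto_atTop_add_const_right _ (-C) (tendsto_norm_cobounded_atTop (E := E))
  refine tendsto_atTop_mono (fun x => ?_) h
  linarith [hC x, norm_sub_norm_le x (H x), norm_sub_rev x (H x)]

/-- Orbit closures are mapped onto the whole space, because the rotation is minimal. -/
theorem image_liftedOrbitClosure (hH : IsLiftedSemiconj L K F α H)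
    (hα : ∀ v : E, ∀ ε > 0, ∃ k : ℕ, ∃ m ∈ L, ‖(k : ℝ) • α + m - v‖ < ε) (x : E) :
    H '' liftedOrbitClosure L F x = Set.univ := by
  have hclosed := hH.isProperMap.isClosedMap _ (isClosed_liftedOrbitClosure (L := L) (F := F) x)
  refine Set.eq_univ_of_forall fun v => ?_
  rw [← hclosed.closure_eq, Metric.mem_closure_iff]
  intro ε hε
  obtain ⟨k, m, hm, h⟩ := hα (v - H x) ε hε
  refine ⟨H (F^[k] x + m), Set.mem_image_of_mem _ (subset_closure ⟨k, m, hm, rfl⟩), ?_⟩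
  rw [hH.map_add _ _ hm, hH.map_iterate, dist_comm, dist_eq_norm]
  rwa [show H x + (k : ℝ) • α + m - v = (k : ℝ) • α + m - (v - H x) by abel]

variable [MeasurableSpace E] [BorelSpace E]
variable [DiscreteTopology L] [IsZLattice ℝ L]

/-- The map with lift `F` is minimal: all orbit closures have volume bounded below, so there are
finitely many of them, and they are open by connectedness. -/
theorem liftedOrbitClosure_eq_univ (hF : IsEquiLipschitzLift L K F)
    (hH : IsLiftedSemiconj L K F α H)
    (hα : ∀ v : E, ∀ ε > 0, ∃ k : ℕ, ∃ m ∈ L, ‖(k : ℝ) • α + m - v‖ < ε) (x : E) :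
    liftedOrbitClosure L F x = Set.univ := by
  obtain ⟨Q, -, hQm, hcov, hQ0, hQt, hmin⟩ :=
    exists_bounded_fundamentalDomain L (μH[finrank ℝ E] : Measure E)
  let c : ENNReal := μH[finrank ℝ E] Q / (K : ENNReal) ^ finrank ℝ E
  have hc : 0 < c := ENNReal.div_pos hQ0 (ENNReal.pow_ne_top ENNReal.coe_ne_top)
  have hvol : ∀ y, c ≤ μH[finrank ℝ E] (liftedOrbitClosure L F y ∩ Q) := fun y => by
    refine ENNReal.div_le_of_le_mul' ?_
    refine (hH.measure_le_of_image_eq_univ hcov hmin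
      (fun z hz m hm => hF.add_mem_liftedOrbitClosure hm hz)
      (hH.image_liftedOrbitClosure hα y)).trans ?_
    simpa using hH.lipschitz.hausdorffMeasure_image_le (d := finrank ℝ E) (by positivity)
      (liftedOrbitClosure L F y ∩ Q)
  have heq : ∀ y z w, w ∈ liftedOrbitClosure L F y → w ∈ liftedOrbitClosure L F z →
      liftedOrbitClosure L F y = liftedOrbitClosure L F z := fun y z w hy hz =>
    ((hF.liftedOrbitClosure_subset (hF.mem_liftedOrbitClosure_symm hy)).trans
      (hF.liftedOrbitClosure_subset hz)).antisymm
    ((hF.liftedOrbitClosure_subset (hF.mem_liftedOrbitClosure_symm hz)).trans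
      (hF.liftedOrbitClosure_subset hy))
  let ι := Set.range (liftedOrbitClosure L F)
  have hfin : {i : ι | c ≤ μH[finrank ℝ E] ((i : Set E) ∩ Q)}.Finite := by
    refine Measure.finite_const_le_meas_of_disjoint_iUnion _ hc (fun i => ?_) ?_ ?_
    · obtain ⟨_, y, rfl⟩ := i
      exact (isClosed_liftedOrbitClosure y).measurableSet.inter hQm
    · rintro ⟨_, y, rfl⟩ ⟨_, z, rfl⟩ hyz
      refine Set.disjoint_left.2 fun w hw hw' => hyz (Subtype.ext ?_)
      exact heq y z w hw.1 hw'.1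
    · exact ne_top_of_le_ne_top hQt (measure_mono (Set.iUnion_subset fun _ => Set.inter_subset_right))
  have : Finite ι := by
    rw [← Set.finite_univ_iff]
    refine hfin.subset fun i _ => ?_
    obtain ⟨_, y, rfl⟩ := i
    exact hvol y
  have hcompl : (liftedOrbitClosure L F x)ᶜ
      = ⋃ i : {i : ι // (i : Set E) ≠ liftedOrbitClosure L F x}, (i : Set E) := by
    ext z
    simp only [Set.mem_compl_iff, Set.mem_iUnion]
    constructor
    · intro hz
      refine ⟨⟨⟨_, z, rfl⟩, fun h => hz ?_⟩, self_mem_liftedOrbitClosure z⟩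
      exact (show liftedOrbitClosure L F z = _ from h) ▸ self_mem_liftedOrbitClosure z
    · rintro ⟨⟨⟨_, y, rfl⟩, hne⟩, hzy⟩ hz
      exact hne (heq y x z hzy hz)
  have hopen : IsOpen (liftedOrbitClosure L F x) := by
    rw [← isClosed_compl_iff, hcompl]
    refine isClosed_iUnion_of_finite fun i => ?_
    obtain ⟨⟨_, y, rfl⟩, -⟩ := i
    exact isClosed_liftedOrbitClosure y
  exact IsClopen.eq_univ ⟨isClosed_liftedOrbitClosure x, hopen⟩ ⟨x, self_mem_liftedOrbitClosure x⟩

/-- Since `H` covers the torus, it cannot contract volume at almost every point. -/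
theorem exists_one_le_abs_det (hH : IsLiftedSemiconj L K F α H)
    (hα : ∀ v : E, ∀ ε > 0, ∃ k : ℕ, ∃ m ∈ L, ‖(k : ℝ) • α + m - v‖ < ε) :
    ∃ y, DifferentiableAt ℝ H y ∧ 1 ≤ |(fderiv ℝ H y).det| := by
  by_contra! hcon
  obtain ⟨Q, -, hQm, hcov, hQ0, hQt, hmin⟩ :=
    exists_bounded_fundamentalDomain L (μH[finrank ℝ E] : Measure E)
  set μ : Measure E := μH[finrank ℝ E]
  let D := {y | DifferentiableAt ℝ H y}
  have hDm : MeasurableSet D := measurableSet_of_differentiableAt ℝ H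
  have hD : μ Dᶜ = 0 := hH.lipschitz.ae_differentiableAt
  have hHD : μ (H '' Dᶜ) = 0 := by
    have := hH.lipschitz.hausdorffMeasure_image_le (d := finrank ℝ E) (by positivity) Dᶜ
    rw [show μH[finrank ℝ E] Dᶜ = 0 from hD, mul_zero] at this
    exact le_antisymm this zero_le
  have hsurj : H '' Set.univ = Set.univ := Set.eq_univ_of_univ_subset <|
    (hH.image_liftedOrbitClosure hα 0).ge.trans (Set.image_mono (Set.subset_univ _))
  have h1 : μ Q ≤ μ (H '' (Set.univ ∩ Q)) :=
    hH.measure_le_of_image_eq_univ hcov hmin (fun _ _ _ _ => Set.mem_univ _) hsurj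
  have h2 : μ (H '' (Set.univ ∩ Q)) ≤ μ (H '' (D ∩ Q)) := by
    refine (measure_mono (t := H '' (D ∩ Q) ∪ H '' Dᶜ) ?_).trans ((measure_union_le _ _).trans ?_)
    · rintro _ ⟨y, ⟨-, hy⟩, rfl⟩
      by_cases hyD : y ∈ D
      · exact Or.inl ⟨y, ⟨hyD, hy⟩, rfl⟩
      · exact Or.inr ⟨y, hyD, rfl⟩
    · rw [hHD, add_zero]
  have h3 : μ (H '' (D ∩ Q)) ≤ ∫⁻ x in D ∩ Q, ENNReal.ofReal |(fderiv ℝ H x).det| ∂μ :=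
    addHaar_image_le_lintegral_abs_det_fderiv μ (hDm.inter hQm)
      fun x hx => (hx.1 : DifferentiableAt ℝ H x).hasFDerivAt.hasFDerivWithinAt
  have hpos : μ (D ∩ Q) ≠ 0 := fun h0 => by
    rw [Measure.restrict_eq_zero.2 h0, lintegral_zero_measure] at h3
    exact hQ0 (le_antisymm (h1.trans (h2.trans h3)) zero_le)
  have hlt : ∀ x ∈ D ∩ Q, ENNReal.ofReal |(fderiv ℝ H x).det| < 1 := fun x hx =>
    ENNReal.ofReal_lt_one.2 (hcon x hx.1)
  have hle : ∫⁻ x in D ∩ Q, ENNReal.ofReal |(fderiv ℝ H x).det| ∂μ ≤ μ (D ∩ Q) := by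
    refine (setLIntegral_mono measurable_const fun x hx => (hlt x hx).le).trans ?_
    simp
  have hDQ : μ (D ∩ Q) ≠ ⊤ := ne_top_of_le_ne_top hQt (measure_mono Set.inter_subset_right)
  have h4 : ∫⁻ x in D ∩ Q, ENNReal.ofReal |(fderiv ℝ H x).det| ∂μ < ∫⁻ _ in D ∩ Q, 1 ∂μ :=
    setLIntegral_strict_mono (hDm.inter hQm) hpos measurable_const
      (ne_top_of_le_ne_top hDQ hle) (Eventually.of_forall hlt)
  rw [setLIntegral_one] at h4
  exact absurd (h1.trans (h2.trans h3)) (not_le.2 (h4.trans_le (measure_mono Set.inter_subset_right)))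

end IsLiftedSemiconj

/-! ### Homogeneity, expansion and invertibility of the semiconjugacy -/

/-- A proper self-map of a normed space that is open and injective on all balls
of some fixed radius is a covering map, hence injective since the space is simply connected. -/
theorem injective_of_isProperMap_of_isOpenMap {E : Type*} [NormedAddCommGroup E]
    [NormedSpace ℝ E] {H : E → E} (hproper : IsProperMap H)
    (hopen : IsOpenMap H) {δ : ℝ} (hδ : 0 < δ) (hinj : ∀ x, Set.InjOn H (Metric.ball x δ)) :
    Function.Injective H := by
  have hloc : IsLocalHomeomorph H := by
    rw [isLocalHomeomorph_iff_isOpenEmbedding_restrict]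
    intro x
    refine ⟨Metric.ball x δ, Metric.ball_mem_nhds x hδ, ?_⟩
    exact .of_continuous_injective_isOpenMap (hproper.continuous.comp continuous_subtype_val)
      (Set.injOn_iff_injective.1 (hinj x)) (hopen.domRestrict Metric.isOpen_ball)
  have hfib : ∀ x, (H ⁻¹' {x}).Finite := fun x =>
    (hproper.isCompact_preimage isCompact_singleton).finite <|
      .of_openPartialHomeomorph H subset_rfl fun e _ => by
        obtain ⟨φ, hφ, h⟩ := hloc e
        exact ⟨φ, hφ, h.symm⟩
  have hcov : IsCoveringMap H := by
    rw [isCoveringMap_iff_isCoveringMapOn_univ]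
    exact hproper.isClosedMap.isCoveringMapOn_of_isLocalHomeomorphOn (fun x _ => hfib x)
      fun e _ => hloc e
  obtain ⟨s, ⟨hs0, hs⟩, -⟩ := hcov.existsUnique_continuousMap_lifts (ContinuousMap.id E) (H 0) 0 rfl
  -- `s ∘ H` and the identity are lifts of `H` that agree at `0`
  have hsH : s ∘ H = id := hcov.eq_of_comp_eq (s.continuous.comp hproper.continuous) continuous_id
    (by rw [← Function.comp_assoc, hs]; rfl) 0 hs0
  exact Function.LeftInverse.injective (congrFun hsH)

namespace IsLiftedSemiconj

section Transport

variable {E : Type*} [NormedAddCommGroup E] [NormedSpace ℝ E] [FiniteDimensional ℝ E]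
  {L : Submodule ℤ E} {K : NNReal} {F H : E → E} {α : E}

/-- Homogeneity of `H`: the pair `(Y, Y')` is carried by iterates of `F` to a pair `(Z, X)` with
prescribed second point; this changes distances by a factor at most `K`, and the difference of the
values of `H` not at all. -/
theorem exists_transport (hF : IsEquiLipschitzLift L K F) (hH : IsLiftedSemiconj L K F α H)
    (hmin : ∀ x, liftedOrbitClosure L F x = Set.univ) {r : ℝ} (hr : ∀ m ∈ L, ‖m‖ < r → m = 0)
    (X Y Y' : E) : ∃ Z, ‖Z - X‖ ≤ K * ‖Y - Y'‖ ∧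
      (‖Y - Y'‖ < r / 2 → ‖Y - Y'‖ ≤ K * ‖Z - X‖) ∧ H Z - H X = H Y - H Y' := by
  have hX : X ∈ liftedOrbitClosure L F Y' := hmin Y' ▸ Set.mem_univ X
  rw [mem_liftedOrbitClosure_iff] at hX
  choose k m hm h using fun i : ℕ => hX (1 / ((i : ℝ) + 1)) Nat.one_div_pos_of_nat
  let u : ℕ → E := fun i => F^[k i] Y + m i
  let w : ℕ → E := fun i => F^[k i] Y' + m i
  have hw : Tendsto w atTop (𝓝 X) := by
    rw [tendsto_iff_norm_sub_tendsto_zero]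
    exact squeeze_zero (fun _ => norm_nonneg _) (fun i => (h i).le)
      tendsto_one_div_add_atTop_nhds_zero_nat
  have huw : ∀ i, u i - w i = F^[k i] Y - F^[k i] Y' := fun i => add_sub_add_right_eq_sub ..
  have hle : ∀ i, ‖u i - w i‖ ≤ K * ‖Y - Y'‖ := fun i => by
    rw [huw]; exact hF.norm_iterate_sub_le _ _ _
  have hub : ∀ i, u i ∈ Metric.closedBall X (K * ‖Y - Y'‖ + 1) := fun i => by
    rw [mem_closedBall_iff_norm]
    have h1 : ‖w i - X‖ ≤ 1 := (h i).le.trans <| by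
      rw [div_le_one (by positivity)]
      exact le_add_of_nonneg_left (Nat.cast_nonneg i)
    exact (norm_sub_le_norm_sub_add_norm_sub _ (w i) _).trans (add_le_add (hle i) h1)
  have := FiniteDimensional.proper_real E
  obtain ⟨Z, -, φ, hφ, hZ⟩ := tendsto_subseq_of_bounded Metric.isBounded_closedBall hub
  have hwφ := hw.comp hφ.tendsto_atTop
  have hlim := (hZ.sub hwφ).norm
  refine ⟨Z, le_of_tendsto' hlim fun i => hle _, fun hYY' => ?_, ?_⟩
  · refine ge_of_tendsto' (hlim.const_mul (K : ℝ)) fun i => ?_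
    simp only [Function.comp_apply, huw]
    exact hF.norm_sub_le_of_lt hr _ hYY'
  · have h1 := ((hH.lipschitz.continuous.tendsto Z).comp hZ).sub
      ((hH.lipschitz.continuous.tendsto X).comp hwφ)
    refine tendsto_nhds_unique h1 (tendsto_const_nhds.congr fun i => ?_)
    simp only [Function.comp_apply, u, w, hH.map_add _ _ (hm _), hH.map_iterate]
    abel

/-- `H` is open, uniformly: by Baire's theorem the image of some small ball has interior points, and
homogeneity moves this ball anywhere. -/
theorem exists_uniform_open (hF : IsEquiLipschitzLift L K F) (hH : IsLiftedSemiconj L K F α H)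
    (hmin : ∀ x, liftedOrbitClosure L F x = Set.univ) (hsurj : Function.Surjective H)
    {ρ : ℝ} (hρ : 0 < ρ) :
    ∃ η > 0, ∀ X W, ‖W - H X‖ < η → ∃ Z, ‖Z - X‖ ≤ ρ ∧ H Z = W := by
  have := FiniteDimensional.proper_real E
  let s : ℝ := ρ / (2 * (K + 1))
  have hs : 0 < s := by positivity
  have hKs : K * (s + s) ≤ ρ := by
    have : (K + 1) * (s + s) = ρ := by simp only [s]; field_simp; ring
    nlinarith
  let q := TopologicalSpace.denseSeq E
  obtain ⟨i, W₀, hW₀⟩ := nonempty_interior_of_iUnion_of_closed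
    (f := fun i : ℕ => H '' Metric.closedBall (q i) s)
    (fun i => ((isCompact_closedBall _ _).image hH.lipschitz.continuous).isClosed) (by
      refine Set.eq_univ_of_forall fun v => ?_
      obtain ⟨x, rfl⟩ := hsurj v
      obtain ⟨_, hi, ⟨i, rfl⟩⟩ := Metric.dense_iff.1 (TopologicalSpace.denseRange_denseSeq E) x s hs
      refine Set.mem_iUnion.2 ⟨i, x, ?_, rfl⟩
      rw [Metric.mem_closedBall, dist_comm]
      exact (Metric.mem_ball.1 hi).le)
  obtain ⟨η, hη, hball⟩ := Metric.mem_nhds_iff.1 (mem_interior_iff_mem_nhds.1 hW₀)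
  obtain ⟨X₀, hX₀, rfl⟩ := hball (Metric.mem_ball_self hη)
  refine ⟨η, hη, fun X W hW => ?_⟩
  obtain ⟨Z₀, hZ₀, hZW⟩ := hball (show W - H X + H X₀ ∈ Metric.ball (H X₀) η by
    rwa [mem_ball_iff_norm, add_sub_cancel_right])
  -- the lower bound at small scale is not needed here, so `r = 0` will do
  obtain ⟨Z, hZ, -, hZH⟩ := hH.exists_transport hF hmin (r := 0)
    (fun m _ hm => absurd hm (not_lt.2 (norm_nonneg m))) X Z₀ X₀
  refine ⟨Z, hZ.trans (le_trans ?_ hKs), ?_⟩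
  · gcongr
    rw [← dist_eq_norm]
    exact (dist_triangle_right _ _ (q i)).trans
      (add_le_add (Metric.mem_closedBall.1 hZ₀) (Metric.mem_closedBall.1 hX₀))
  · rw [hZW, add_sub_cancel_right] at hZH
    exact sub_left_injective hZH

end Transport

section Expansion

variable {E : Type*} [NormedAddCommGroup E] [InnerProductSpace ℝ E] [FiniteDimensional ℝ E]
  {L : Submodule ℤ E} {K : NNReal} {F H : E → E} {α : E}

/-- At small scale `H` contracts distances at most by a factor close to `K ^ (-dim E)`: carry one of
the two points close to a point `y` where `|det DH| ≥ 1`, and use Hadamard's inequality there. -/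
theorem exists_local_expansion (hF : IsEquiLipschitzLift L K F) (hH : IsLiftedSemiconj L K F α H)
    (hmin : ∀ x, liftedOrbitClosure L F x = Set.univ) {r : ℝ} (hr0 : 0 < r)
    (hr : ∀ m ∈ L, ‖m‖ < r → m = 0) {y : E} (hy : DifferentiableAt ℝ H y)
    (hdet : 1 ≤ |(fderiv ℝ H y).det|) {ε : ℝ} (hε : 0 < ε) :
    ∃ δ > 0, ∀ Y Y' : E, ‖Y - Y'‖ < δ →
      ‖Y - Y'‖ ≤ K ^ finrank ℝ E * ‖H Y - H Y'‖ + ε * ‖Y - Y'‖ := by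
  rcases subsingleton_or_nontrivial E with hE | hE
  · refine ⟨1, one_pos, fun Y Y' _ => ?_⟩
    rw [Subsingleton.elim Y Y']
    simp
  obtain ⟨d, hd⟩ : ∃ d, finrank ℝ E = d + 1 := ⟨_, (Nat.succ_pred_eq_of_pos finrank_pos).symm⟩
  -- the error `c ‖z - y‖` of the linear approximation gets multiplied by `K ^ (d + 2)` below
  let c : ℝ := ε / (K ^ (d + 2) + 1)
  have hc : 0 < c := by positivity
  have hKc : K ^ (d + 2) * c ≤ ε := by
    simp only [c]
    rw [mul_div_assoc', div_le_iff₀ (by positivity)]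
    nlinarith
  obtain ⟨δ₀, hδ₀, hlin⟩ := Metric.eventually_nhds_iff.1 (hy.hasFDerivAt.isLittleO.def hc)
  refine ⟨min (r / 2) (δ₀ / (K + 1)), by positivity, fun Y Y' hYY' => ?_⟩
  obtain ⟨Z, hZ1, hZ2, hZ3⟩ := hH.exists_transport hF hmin hr y Y Y'
  have h1 := hZ2 (hYY'.trans_le (min_le_left _ _))
  have hZδ : dist Z y < δ₀ := by
    have h2 := hYY'.trans_le (min_le_right _ _)
    rw [lt_div_iff₀ (by positivity)] at h2
    rw [dist_eq_norm]
    nlinarith [norm_nonneg (Y - Y')]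
  have h2 := hlin hZδ
  rw [hZ3] at h2
  have h3 := abs_det_mul_norm_le (fderiv ℝ H y) (norm_fderiv_le_of_lipschitz ℝ hH.lipschitz) (Z - y)
  rw [hd, Nat.add_sub_cancel] at h3
  have h4 : ‖Z - y‖ ≤ |(fderiv ℝ H y).det| * ‖Z - y‖ := le_mul_of_one_le_left (norm_nonneg _) hdet
  have h5 : ‖fderiv ℝ H y (Z - y)‖ ≤ ‖H Y - H Y'‖ + c * (K * ‖Y - Y'‖) := by
    have h6 := norm_sub_norm_le (fderiv ℝ H y (Z - y)) (H Y - H Y')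
    rw [norm_sub_rev (fderiv ℝ H y (Z - y))] at h6
    have h7 : c * ‖Z - y‖ ≤ c * (K * ‖Y - Y'‖) := by gcongr
    linarith
  calc ‖Y - Y'‖ ≤ K * ‖Z - y‖ := h1
    _ ≤ K * (K ^ d * (‖H Y - H Y'‖ + c * (K * ‖Y - Y'‖))) := by
      gcongr
      exact h4.trans (h3.trans (by gcongr))
    _ = K ^ (d + 1) * ‖H Y - H Y'‖ + K ^ (d + 2) * c * ‖Y - Y'‖ := by ring
    _ ≤ K ^ finrank ℝ E * ‖H Y - H Y'‖ + ε * ‖Y - Y'‖ := by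
      rw [hd]
      gcongr

variable [DiscreteTopology L] [IsZLattice ℝ L]

/-- The semiconjugacy is bijective, with `K ^ dim E`-Lipschitz inverse. -/
theorem antilipschitz (hF : IsEquiLipschitzLift L K F) (hH : IsLiftedSemiconj L K F α H)
    (hα : ∀ v : E, ∀ ε > 0, ∃ k : ℕ, ∃ m ∈ L, ‖(k : ℝ) • α + m - v‖ < ε) :
    Function.Surjective H ∧ AntilipschitzWith (K ^ finrank ℝ E) H := by
  borelize E
  have hmin := hH.liftedOrbitClosure_eq_univ hF hα
  obtain ⟨y, hy, hdet⟩ := hH.exists_one_le_abs_det hα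
  obtain ⟨r, hr0, hr⟩ := exists_pos_forall_mem_lattice_norm_lt L
  have hexp := fun {ε : ℝ} (hε : 0 < ε) => hH.exists_local_expansion hF hmin hr0 hr hy hdet hε
  have hsurj : Function.Surjective H := fun v => by
    obtain ⟨x, -, hx⟩ : v ∈ H '' liftedOrbitClosure L F 0 :=
      hH.image_liftedOrbitClosure hα 0 ▸ Set.mem_univ v
    exact ⟨x, hx⟩
  have hunif := fun {ρ : ℝ} (hρ : 0 < ρ) => hH.exists_uniform_open hF hmin hsurj hρ
  have hopen : IsOpenMap H := by
    refine isOpenMap_iff_nhds_le.2 fun X => ?_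
    intro U hU
    obtain ⟨ρ, hρ, hball⟩ := Metric.mem_nhds_iff.1 (mem_map.1 hU)
    obtain ⟨η, hη, h⟩ := hunif (half_pos hρ)
    refine Metric.mem_nhds_iff.2 ⟨η, hη, fun W hW => ?_⟩
    obtain ⟨Z, hZ, rfl⟩ := h X W (mem_ball_iff_norm.1 hW)
    exact hball (mem_ball_iff_norm.2 (by linarith))
  have hinj : Function.Injective H := by
    obtain ⟨δ, hδ, h⟩ := hexp (ε := 1 / 2) (by norm_num)
    refine injective_of_isProperMap_of_isOpenMap hH.isProperMap hopen (half_pos hδ)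
      fun x a ha b hb hab => ?_
    have h1 : ‖a - b‖ < δ := by
      rw [← dist_eq_norm]
      have := dist_triangle_right a b x
      rw [Metric.mem_ball] at ha hb
      linarith
    have h2 := h a b h1
    rw [hab, sub_self, norm_zero, mul_zero, zero_add] at h2
    have h3 := norm_nonneg (a - b)
    exact sub_eq_zero.1 (norm_eq_zero.1 (by linarith))
  refine ⟨hsurj, ?_⟩
  obtain ⟨G, hG⟩ := hsurj.hasRightInverse
  have hGH : ∀ x, G (H x) = x := fun x => hinj (hG (H x))
  refine AntilipschitzWith.of_le_mul_dist fun a b => ?_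
  -- `G` is Lipschitz with every constant larger than `K ^ finrank ℝ E`
  have key : ∀ ε : ℝ, 0 < ε → ε < 1 →
      (1 - ε) * dist a b ≤ (K ^ finrank ℝ E : NNReal) * dist (H a) (H b) := by
    intro ε hε hε1
    have hε' : 0 < 1 - ε := by linarith
    obtain ⟨δ, hδ, h⟩ := hexp hε
    obtain ⟨η, hη, hη'⟩ := hunif (half_pos hδ)
    have hlip : LipschitzWith (K ^ finrank ℝ E / (1 - ε).toNNReal) G := by
      refine lipschitzWith_of_eventually_dist_le fun W => ?_
      filter_upwards [Metric.ball_mem_nhds W hη] with W' hW'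
      obtain ⟨Z, hZ, rfl⟩ := hη' (G W) W' (by rw [hG]; exact mem_ball_iff_norm.1 hW')
      have h1 := h Z (G W) (by linarith)
      rw [hG] at h1
      rw [hGH, dist_eq_norm, dist_eq_norm, NNReal.coe_div, Real.coe_toNNReal _ hε'.le,
        div_mul_eq_mul_div, le_div_iff₀ hε']
      push_cast
      linarith
    have h1 := hlip.dist_le_mul (H a) (H b)
    rw [hGH, hGH, NNReal.coe_div, Real.coe_toNNReal _ hε'.le, div_mul_eq_mul_div,
      le_div_iff₀ hε'] at h1
    linarith
  have hlim : Tendsto (fun ε : ℝ => (1 - ε) * dist a b) (𝓝[>] 0) (𝓝 ((1 - 0) * dist a b)) :=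
    ((continuous_const.sub continuous_id).mul continuous_const).continuousWithinAt
  rw [sub_zero, one_mul] at hlim
  refine le_of_tendsto hlim ?_
  filter_upwards [Ioo_mem_nhdsGT (zero_lt_one' ℝ)] with ε hε using key ε hε.1 hε.2

end Expansion

end IsLiftedSemiconj

/-! ### The torus -/

namespace FlatTorus

variable {n : ℕ}

theorem proj_add (x y : EuclideanSpace ℝ (Fin n)) : proj (x + y) = proj x + proj y := rfl

theorem proj_sub (x y : EuclideanSpace ℝ (Fin n)) : proj (x - y) = proj x - proj y := rfl

theorem proj_intVec (m : Fin n → ℤ) : proj (intVec m) = 0 := by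
  ext i
  exact (AddCircle.coe_eq_zero_iff 1).2 ⟨m i, by simp [intVec]⟩

theorem proj_surjective : Function.Surjective (proj (n := n)) := fun x => by
  choose y hy using fun i => QuotientAddGroup.mk_surjective (x i)
  exact ⟨WithLp.toLp 2 y, by ext i; exact hy i⟩

theorem norm_proj_le (v : EuclideanSpace ℝ (Fin n)) : ‖proj v‖ ≤ ‖v‖ := by
  rw [PiLp.norm_eq_of_L2, EuclideanSpace.norm_eq]
  refine Real.sqrt_le_sqrt (Finset.sum_le_sum fun i _ => ?_)
  gcongr
  exact (UnitAddCircle.norm_eq (x := v i)).trans_le (by simpa using round_le (v i) 0)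

/-- The distance on the torus is the quotient distance, and it is attained. -/
theorem exists_norm_sub_intVec_eq (v : EuclideanSpace ℝ (Fin n)) :
    ∃ m, ‖v - intVec m‖ = ‖proj v‖ := by
  refine ⟨fun i => round (v i), ?_⟩
  rw [EuclideanSpace.norm_eq, PiLp.norm_eq_of_L2]
  congr 1
  refine Finset.sum_congr rfl fun i _ => ?_
  congr 1
  exact (UnitAddCircle.norm_eq (x := v i)).symm

/-- The projection is isometric at small scale. -/
theorem norm_proj_eq {v : EuclideanSpace ℝ (Fin n)} (hv : ‖v‖ ≤ 1 / 2) : ‖proj v‖ = ‖v‖ := by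
  rw [PiLp.norm_eq_of_L2, EuclideanSpace.norm_eq]
  congr 1
  refine Finset.sum_congr rfl fun i _ => ?_
  congr 1
  have hi : |v i| ≤ |(1 : ℝ)| / 2 := by
    rw [abs_one]
    exact (PiLp.norm_apply_le v i).trans hv
  exact (AddCircle.norm_coe_eq_abs_iff 1 one_ne_zero).2 hi

/-- The lattice `ℤⁿ` in `ℝⁿ`. -/
def intLattice (n : ℕ) : Submodule ℤ (EuclideanSpace ℝ (Fin n)) :=
  Submodule.span ℤ (Set.range (EuclideanSpace.basisFun (Fin n) ℝ).toBasis)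

instance : DiscreteTopology (intLattice n) :=
  inferInstanceAs (DiscreteTopology (Submodule.span ℤ (Set.range _)))

instance : IsZLattice ℝ (intLattice n) :=
  inferInstanceAs (IsZLattice ℝ (Submodule.span ℤ (Set.range _)))

theorem mem_intLattice_iff {v : EuclideanSpace ℝ (Fin n)} :
    v ∈ intLattice n ↔ ∃ m, v = intVec m := by
  rw [intLattice, Basis.mem_span_iff_repr_mem]
  simp only [EuclideanSpace.basisFun_toBasis, PiLp.basisFun_repr, Set.mem_range]
  constructor
  · intro h
    choose m hm using h
    exact ⟨m, by ext i; simpa [intVec] using (hm i).symm⟩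
  · rintro ⟨m, rfl⟩ i
    exact ⟨m i, by simp [intVec]⟩

theorem proj_eq_zero_of_mem {v : EuclideanSpace ℝ (Fin n)} (hv : v ∈ intLattice n) :
    proj v = 0 := by
  obtain ⟨m, rfl⟩ := mem_intLattice_iff.1 hv
  exact proj_intVec m

theorem exists_mem_intLattice_norm_sub_eq (v : EuclideanSpace ℝ (Fin n)) :
    ∃ m ∈ intLattice n, ‖v - m‖ = ‖proj v‖ := by
  obtain ⟨m, hm⟩ := exists_norm_sub_intVec_eq v
  exact ⟨_, mem_intLattice_iff.2 ⟨m, rfl⟩, hm⟩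

section Lift

variable {g : FlatTorus n ≃ₜ FlatTorus n} {K : NNReal}
  {F : EuclideanSpace ℝ (Fin n) → EuclideanSpace ℝ (Fin n)}

theorem IsLift.proj_iterate (hF : IsLift F g) (k : ℕ) (x : EuclideanSpace ℝ (Fin n)) :
    proj (F^[k] x) = (g ^ (k : ℤ) : FlatTorus n ≃ₜ FlatTorus n) (proj x) := by
  induction k with
  | zero => simp
  | succ k ih =>
    rw [Function.iterate_succ_apply', hF.proj_apply, ih, Nat.cast_succ, add_comm, zpow_add, zpow_one]
    rfl

theorem IsLift.isEquiLipschitzLift (hF : IsLift F g)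
    (hg : ∀ k : ℤ, LipschitzWith K (g ^ k : FlatTorus n ≃ₜ FlatTorus n)) :
    IsEquiLipschitzLift (intLattice n) K F where
  map_add x m hm := by
    obtain ⟨m, rfl⟩ := mem_intLattice_iff.1 hm
    exact hF.add_intVec x m
  lipschitz k := by
    refine lipschitzWith_of_eventually_dist_le fun x => ?_
    have hk : Continuous F^[k] := hF.continuous.iterate k
    filter_upwards [hk.continuousAt (Metric.ball_mem_nhds (F^[k] x) (one_half_pos (α := ℝ)))]
      with y hy
    have hy' : ‖F^[k] y - F^[k] x‖ < 1 / 2 := mem_ball_iff_norm.1 hy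
    rw [dist_eq_norm, ← norm_proj_eq hy'.le, proj_sub, ← dist_eq_norm, hF.proj_iterate,
      hF.proj_iterate]
    refine ((hg k).dist_le_mul _ _).trans ?_
    gcongr
    rw [dist_eq_norm, ← proj_sub, dist_eq_norm]
    exact norm_proj_le _
  exists_norm_sub_le k a b := by
    obtain ⟨m, hm, h⟩ := exists_mem_intLattice_norm_sub_eq (a - b)
    refine ⟨m, hm, ?_⟩
    have h1 := (hg (-k)).dist_le_mul (proj (F^[k] a)) (proj (F^[k] b))
    have h2 : ∀ x, (g ^ (-k : ℤ) : FlatTorus n ≃ₜ FlatTorus n) (proj (F^[k] x)) = proj x := fun x => by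
      rw [hF.proj_iterate, zpow_neg]
      exact (g ^ (k : ℤ) : FlatTorus n ≃ₜ FlatTorus n).symm_apply_apply _
    rw [h2, h2, dist_eq_norm, dist_eq_norm, ← proj_sub, ← proj_sub] at h1
    rw [h]
    refine h1.trans ?_
    gcongr
    exact norm_proj_le _

end Lift

theorem isRotationVector_of_norm_le {F : EuclideanSpace ℝ (Fin n) → EuclideanSpace ℝ (Fin n)}
    {α : EuclideanSpace ℝ (Fin n)} {C : ℝ}
    (h : ∀ (k : ℕ) (x : EuclideanSpace ℝ (Fin n)), ‖F^[k] x - x - (k : ℝ) • α‖ ≤ C) :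
    IsRotationVector F α := by
  rw [IsRotationVector, Metric.tendstoUniformly_iff]
  intro ε hε
  have hC : Tendsto (fun k : ℕ => (k : ℝ)⁻¹ * C) atTop (𝓝 (0 * C)) :=
    tendsto_inv_atTop_nhds_zero_nat.mul_const C
  rw [zero_mul] at hC
  filter_upwards [hC.eventually_lt_const hε, eventually_gt_atTop 0] with k hk hk0 x
  have hk' : (k : ℝ) ≠ 0 := by exact_mod_cast hk0.ne'
  have e : (k : ℝ)⁻¹ • (F^[k] x - x) - α = (k : ℝ)⁻¹ • (F^[k] x - x - (k : ℝ) • α) := by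
    rw [smul_sub _ (F^[k] x - x), inv_smul_smul₀ hk']
  rw [dist_comm, dist_eq_norm, e, norm_smul, norm_inv, RCLike.norm_natCast]
  refine lt_of_le_of_lt ?_ hk
  gcongr
  exact h k x

theorem IsRotationVector.unique {F : EuclideanSpace ℝ (Fin n) → EuclideanSpace ℝ (Fin n)}
    {α β : EuclideanSpace ℝ (Fin n)} (hα : IsRotationVector F α) (hβ : IsRotationVector F β) :
    α = β :=
  tendsto_nhds_unique (hα.tendsto_at 0) (hβ.tendsto_at 0)

section Ergodic

instance : IsFiniteMeasure (leb n) :=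
  inferInstanceAs (IsFiniteMeasure (Measure.map _ _))

theorem leb_pos_of_isOpen {U : Set (FlatTorus n)} (hU : IsOpen U) (hne : U.Nonempty) :
    leb n U ≠ 0 := by
  have hc : Continuous (WithLp.toLp 2 : (Fin n → UnitAddCircle) → FlatTorus n) :=
    PiLp.continuous_toLp 2 _
  rw [leb, Measure.map_apply hc.measurable hU.measurableSet]
  obtain ⟨x, hx⟩ := hne
  exact ((hU.preimage hc).measure_pos _ ⟨WithLp.ofLp x, hx⟩).ne'

/-- An ergodic rotation is minimal: a neighbourhood of the forward orbit of `0` is mapped into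
itself, hence has full measure. -/
theorem exists_dist_proj_smul_lt {α : EuclideanSpace ℝ (Fin n)}
    (h : Ergodic (rotation α) (leb n)) (y : FlatTorus n) {ε : ℝ} (hε : 0 < ε) :
    ∃ k : ℕ, dist (proj ((k : ℝ) • α)) y < ε := by
  let S : Set (FlatTorus n) := ⋃ k : ℕ, Metric.ball (proj ((k : ℝ) • α)) (ε / 2)
  have hS : IsOpen S := isOpen_iUnion fun _ => Metric.isOpen_ball
  have hmaps : S ⊆ rotation α ⁻¹' S := fun x hx => by
    obtain ⟨k, hk⟩ := Set.mem_iUnion.1 hx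
    refine Set.mem_iUnion.2 ⟨k + 1, ?_⟩
    rw [Metric.mem_ball] at hk ⊢
    rwa [Nat.cast_succ, add_smul, one_smul, proj_add, rotation, dist_add_right]
  have hne : S.Nonempty := ⟨_, Set.mem_iUnion.2 ⟨0, Metric.mem_ball_self (half_pos hε)⟩⟩
  rcases h.ae_empty_or_univ_of_ae_le_preimage hS.measurableSet.nullMeasurableSet
    (LE.le.eventuallyLE hmaps) with h0 | h1
  · exact absurd (ae_eq_empty.1 h0) (leb_pos_of_isOpen hS hne)
  · by_contra! hcon
    refine leb_pos_of_isOpen (Metric.isOpen_ball (x := y) (ε := ε / 2))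
      ⟨y, Metric.mem_ball_self (half_pos hε)⟩ (measure_mono_null ?_ (ae_eq_univ.1 h1))
    intro z hz hzS
    obtain ⟨k, hk⟩ := Set.mem_iUnion.1 hzS
    have := dist_triangle_left (proj ((k : ℝ) • α)) y z
    rw [Metric.mem_ball] at hz hk
    linarith [hcon k]

theorem exists_norm_smul_add_sub_lt {α : EuclideanSpace ℝ (Fin n)}
    (h : Ergodic (rotation α) (leb n)) (v : EuclideanSpace ℝ (Fin n)) (ε : ℝ) (hε : ε > 0) :
    ∃ k : ℕ, ∃ m ∈ intLattice n, ‖(k : ℝ) • α + m - v‖ < ε := by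
  obtain ⟨k, hk⟩ := exists_dist_proj_smul_lt h (proj v) hε
  obtain ⟨m, hm, hmk⟩ := exists_mem_intLattice_norm_sub_eq ((k : ℝ) • α - v)
  refine ⟨k, -m, neg_mem hm, ?_⟩
  rw [dist_eq_norm, ← proj_sub, ← hmk] at hk
  rwa [show (k : ℝ) • α + -m - v = (k : ℝ) • α - v - m by abel]

/-- The centralizer of a minimal rotation consists of rotations. -/
theorem eq_add_of_commute_rotation {α : EuclideanSpace ℝ (Fin n)}
    (h : Ergodic (rotation α) (leb n)) {c : FlatTorus n → FlatTorus n} (hc : Continuous c)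
    (hcomm : ∀ y, c (rotation α y) = rotation α (c y)) (y : FlatTorus n) : c y = y + c 0 := by
  have hdense : DenseRange fun k : ℕ => proj ((k : ℝ) • α) := fun z => by
    rw [Metric.mem_closure_iff]
    intro ε hε
    obtain ⟨k, hk⟩ := exists_dist_proj_smul_lt h z hε
    exact ⟨_, ⟨k, rfl⟩, by rwa [dist_comm]⟩
  suffices h : c = fun z => z + c 0 from congrFun h y
  refine hdense.equalizer hc (continuous_id.add continuous_const) (funext fun k => ?_)
  induction k with
  | zero =>
    have : proj ((0 : ℝ) • α) = 0 := by rw [zero_smul]; rfl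
    simp only [Function.comp_apply, Nat.cast_zero, this, zero_add]
  | succ k ih =>
    have e : proj (((k + 1 : ℕ) : ℝ) • α) = rotation α (proj ((k : ℝ) • α)) := by
      rw [Nat.cast_succ, add_smul, one_smul]; rfl
    simp only [Function.comp_apply] at ih ⊢
    rw [e, hcomm, ih, rotation, rotation]
    abel

end Ergodic

section Descend

/-- The map of the torus induced by a map of `ℝⁿ`; it is meaningful when the latter commutes with
integer translations. -/
noncomputable def descend (H : EuclideanSpace ℝ (Fin n) → EuclideanSpace ℝ (Fin n))
    (x : FlatTorus n) : FlatTorus n :=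
  proj (H (Function.surjInv proj_surjective x))

variable {H G : EuclideanSpace ℝ (Fin n) → EuclideanSpace ℝ (Fin n)}

theorem descend_proj (hH : ∀ x, ∀ m ∈ intLattice n, H (x + m) = H x + m)
    (x : EuclideanSpace ℝ (Fin n)) : descend H (proj x) = proj (H x) := by
  let x' := Function.surjInv proj_surjective (proj x)
  have hx' : proj x' = proj x := Function.surjInv_eq proj_surjective _
  obtain ⟨m, hm, h⟩ := exists_mem_intLattice_norm_sub_eq (x' - x)
  rw [proj_sub, hx', sub_self, norm_zero, norm_eq_zero, sub_sub, sub_eq_zero] at h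
  change proj (H x') = _
  rw [h, hH x m hm, proj_add, proj_eq_zero_of_mem hm, add_zero]

theorem lipschitzWith_descend (hH : ∀ x, ∀ m ∈ intLattice n, H (x + m) = H x + m) {C : NNReal}
    (hC : LipschitzWith C H) : LipschitzWith C (descend H) := by
  refine LipschitzWith.of_dist_le_mul fun x y => ?_
  obtain ⟨X, rfl⟩ := proj_surjective x
  obtain ⟨Y, rfl⟩ := proj_surjective y
  obtain ⟨m, hm, h⟩ := exists_mem_intLattice_norm_sub_eq (X - Y)
  have hY : proj (H Y) = proj (H (Y + m)) := by
    rw [hH Y m hm, proj_add, proj_eq_zero_of_mem hm, add_zero]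
  rw [descend_proj hH, descend_proj hH, hY, dist_eq_norm, dist_eq_norm, ← proj_sub, ← proj_sub, ← h,
    sub_sub, ← dist_eq_norm X]
  exact (norm_proj_le _).trans ((dist_eq_norm _ _).symm.trans_le (hC.dist_le_mul _ _))

theorem descend_comp (hH : ∀ x, ∀ m ∈ intLattice n, H (x + m) = H x + m)
    (hG : ∀ x, ∀ m ∈ intLattice n, G (x + m) = G x + m) (hHG : ∀ x, H (G x) = x) (x : FlatTorus n) :
    descend H (descend G x) = x := by
  obtain ⟨X, rfl⟩ := proj_surjective x
  rw [descend_proj hG, descend_proj hH, hHG]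

end Descend

/-- Under an ergodic rotation, the lifted semiconjugacy descends to a conjugacy. -/
theorem exists_conjugacy {K : NNReal} {g : FlatTorus n ≃ₜ FlatTorus n}
    {F : EuclideanSpace ℝ (Fin n) → EuclideanSpace ℝ (Fin n)} (hF : IsLift F g)
    (hFK : IsEquiLipschitzLift (intLattice n) K F) {α : EuclideanSpace ℝ (Fin n)} {C : ℝ}
    (hC : ∀ (k : ℕ) (x : EuclideanSpace ℝ (Fin n)), ‖F^[k] x - x - (k : ℝ) • α‖ ≤ C)
    (herg : Ergodic (rotation α) (leb n)) :
    ∃ h : FlatTorus n ≃ₜ FlatTorus n, LipschitzWith K h ∧ LipschitzWith (K ^ n) h.symm ∧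
      ∀ x, h (g x) = rotation α (h x) := by
  obtain ⟨H, hHK, hHL, hHF, hHC⟩ := hFK.exists_semiconj hC
  have hH : IsLiftedSemiconj (intLattice n) K F α H := ⟨hHK, hHL, hHF, C, hHC⟩
  obtain ⟨hsurj, hanti⟩ := hH.antilipschitz hFK (exists_norm_smul_add_sub_lt herg)
  rw [finrank_euclideanSpace_fin] at hanti
  obtain ⟨G, hG⟩ := hsurj.hasRightInverse
  have hGL : ∀ x, ∀ m ∈ intLattice n, G (x + m) = G x + m := fun x m hm =>
    hanti.injective (by rw [hG, hHL _ m hm, hG])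
  have h1 := lipschitzWith_descend hHL hHK
  have h2 := lipschitzWith_descend hGL (hanti.to_rightInverse hG)
  refine ⟨⟨⟨descend H, descend G, descend_comp hGL hHL fun x => hanti.injective (hG _),
    descend_comp hHL hGL hG⟩, h1.continuous, h2.continuous⟩, h1, h2, fun x => ?_⟩
  obtain ⟨X, rfl⟩ := proj_surjective x
  change descend H (g (proj X)) = rotation α (descend H (proj X))
  rw [← hF.proj_apply, descend_proj hHL, descend_proj hHL, hHF]
  rfl

end FlatTorus

theorem mainTheorem6 (n : ℕ) (K : NNReal) (g : FlatTorus n ≃ₜ FlatTorus n)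
    (hg : ∀ k : ℤ, LipschitzWith K (g ^ k : FlatTorus n ≃ₜ FlatTorus n))
    (F : EuclideanSpace ℝ (Fin n) → EuclideanSpace ℝ (Fin n)) (hF : FlatTorus.IsLift F g) :
    (∃! α, FlatTorus.IsRotationVector F α) ∧
    ∀ α, FlatTorus.IsRotationVector F α →
      Ergodic (FlatTorus.rotation α) (FlatTorus.leb n) →
      (∃ h : FlatTorus n ≃ₜ FlatTorus n,
        (∃ L : NNReal, LipschitzWith L h ∧ LipschitzWith L h.symm) ∧
        h ∘ g = FlatTorus.rotation α ∘ h) ∧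
      ∀ h : FlatTorus n ≃ₜ FlatTorus n, h ∘ g = FlatTorus.rotation α ∘ h →
        LipschitzWith K h ∧ LipschitzWith (K ^ n) h.symm := by
  have hFK := hF.isEquiLipschitzLift hg
  obtain ⟨β, C, hC⟩ := hFK.exists_norm_iterate_sub_le
  have hβ := FlatTorus.isRotationVector_of_norm_le hC
  refine ⟨⟨β, hβ, fun γ hγ => hγ.unique hβ⟩, fun α hα herg => ?_⟩
  obtain rfl := hα.unique hβ
  obtain ⟨h₀, h₀K, h₀K', hconj⟩ := FlatTorus.exists_conjugacy hF hFK hC herg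
  refine ⟨⟨h₀, ⟨max K (K ^ n), h₀K.weaken (le_max_left _ _), h₀K'.weaken (le_max_right _ _)⟩,
    funext hconj⟩, fun h hh => ?_⟩
  -- `h ∘ h₀⁻¹` commutes with the rotation, so `h` is `h₀` followed by a translation
  have hc : ∀ y, h (h₀.symm y) = y + h (h₀.symm 0) :=
    FlatTorus.eq_add_of_commute_rotation herg (h.continuous.comp h₀.symm.continuous) fun y => by
      have h1 : h₀.symm (FlatTorus.rotation α y) = g (h₀.symm y) := by
        rw [h₀.symm_apply_eq, hconj, h₀.apply_symm_apply]
      rw [h1]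
      exact congrFun hh _
  set t := h (h₀.symm 0)
  have hx : ∀ x, h x = h₀ x + t := fun x => by rw [← hc, h₀.symm_apply_apply]
  have hy : ∀ y, h.symm y = h₀.symm (y - t) := fun y => by
    rw [h.symm_apply_eq, hc, sub_add_cancel]
  constructor
  · refine LipschitzWith.of_dist_le_mul fun x y => ?_
    rw [hx, hx, dist_add_right]
    exact h₀K.dist_le_mul x y
  · refine LipschitzWith.of_dist_le_mul fun x y => ?_
    rw [hy, hy, ← dist_sub_right x y t]
    exact h₀K'.dist_le_mul _ _
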